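/- Let $G$ be a finite simple graph on $n\ge 4$ vertices. Write $\delta(G)$ for its minimum degree and $\rho(G)$ for its spectral radius, that is, the largest eigenvalue of its adjacency matrix. As usual, $G_1+G_2$ denotes the disjoint union of two graphs, $kG_1$ the disjoint union of $k$ copies of $G_1$, and $G_1\vee G_2$ the join, obtained from $G_1+G_2$ by joining every vertex of $G_1$ to every vertex of $G_2$. If $\delta(G)\ge 1$ and $\rho(G)>n-3$, then $G$ contains a Hamilton path, unless $G$ is isomorphic to one of $$K_1\vee (K_{n-3}+2K_1),\qquad K_2\vee 4K_1,\qquad K_1\vee (K_{1,3}+K_1)$$ (the last two having $n=6$). Each of these graphs is a genuine exception: it has minimum degree at least $1$ and spectral radius greater than $n-3$, where $n$ is its number of vertices, but it contains no Hamilton path. -/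

import Mathlib

namespace SimpleGraph

/-- The spectral radius `ρ(G)`: the largest eigenvalue of the (real) adjacency matrix of `G`.
(For a nonempty vertex set the supremum is attained, see `isGreatest_adjSpectralRadius`.) -/
noncomputable def adjSpectralRadius {V : Type*} [Fintype V] [DecidableEq V]
    (G : SimpleGraph V) [DecidableRel G.Adj] : ℝ :=
  sSup {μ : ℝ | Module.End.HasEigenvalue (Matrix.toLin' (G.adjMatrix ℝ)) μ}

theorem isGreatest_adjSpectralRadius {V : Type*} [Fintype V] [DecidableEq V] [Nonempty V]
    (G : SimpleGraph V) [DecidableRel G.Adj] :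
    IsGreatest {μ : ℝ | Module.End.HasEigenvalue (Matrix.toLin' (G.adjMatrix ℝ)) μ}
      G.adjSpectralRadius := by
  have hA : (G.adjMatrix ℝ).IsHermitian := G.isHermitian_adjMatrix ℝ
  have h : {μ : ℝ | Module.End.HasEigenvalue (Matrix.toLin' (G.adjMatrix ℝ)) μ}
      = Set.range hA.eigenvalues := by
    ext μ
    rw [Set.mem_ofPred_eq, Module.End.hasEigenvalue_iff_mem_spectrum, Matrix.spectrum_toLin',
      hA.spectrum_real_eq_range_eigenvalues]
  unfold adjSpectralRadius
  rw [h]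
  exact ⟨(Set.range_nonempty _).csSup_mem (Set.finite_range _),
    fun _ hx => le_csSup (Set.finite_range _).bddAbove hx⟩

/-- The join `G ∨ H`: the disjoint union of `G` and `H` together with all edges between a vertex
of `G` and a vertex of `H`. -/
def join {V W : Type*} (G : SimpleGraph V) (H : SimpleGraph W) : SimpleGraph (V ⊕ W) :=
  (G ⊕g H) ⊔ completeBipartiteGraph V W

/-- `G` contains a Hamilton path: a path through all vertices of `G`. -/
def HasHamiltonPath {V : Type*} [DecidableEq V] (G : SimpleGraph V) : Prop :=
  ∃ (u v : V) (p : G.Walk u v), p.IsHamiltonian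

/-- `G` is, up to isomorphism, one of the graphs `K₁ ∨ (K_{n-3} + 2K₁)`, `K₂ ∨ 4K₁` and
`K₁ ∨ (K_{1,3} + K₁)`. Here `⊥` on `Fin k` is `kK₁`, the graph with `k` isolated vertices. -/
def IsExceptional {V : Type*} (n : ℕ) (G : SimpleGraph V) : Prop :=
  Nonempty (G ≃g join (completeGraph (Fin 1))
      (completeGraph (Fin (n - 3)) ⊕g (⊥ : SimpleGraph (Fin 2)))) ∨
  Nonempty (G ≃g join (completeGraph (Fin 2)) (⊥ : SimpleGraph (Fin 4))) ∨
  Nonempty (G ≃g join (completeGraph (Fin 1))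
      (completeBipartiteGraph (Fin 1) (Fin 3) ⊕g completeGraph (Fin 1)))

end SimpleGraph

/-! Suppose `G` has no Hamilton path. Hong's bound `ρ² ≤ 2m - n + 1`, with `m` the number of edges,
together with `ρ > n - 3` and parity gives `2m ≥ n² - 5n + 10`. Chvátal's argument, run in an
edge-maximal supergraph without Hamilton path, gives some `k ≤ n/2` with `k` vertices of degree at
most `k - 1`, lying among `n - k + 1` vertices of degree at most `n - k - 1`.

The case `k = 1` contradicts `δ ≥ 1`. For `k = 2` these degree bounds allow at most `2 + (n-3)² +
(n-1) = n² - 5n + 10` for the degree sum, so every bound is tight and the graph is `K₁ ∨ (K_{n-3} +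
2K₁)`. For `k ≥ 3` a positive test vector, constant on three classes, gives `ρ ≤ n - 3`, except when
`k = 3` and `n = 6`. There, counting at least eight edges on six vertices leaves a graph with a
Hamilton path, the two sporadic exceptions, or a graph with `ρ ≤ 3`.

Conversely, in each exception deleting one or two vertices leaves too many components for a Hamilton
path, and an explicit trial vector has Rayleigh quotient above `n - 3`. -/

namespace SimpleGraph

/-! ### Hamilton paths as lists of vertices. -/

section Traceable

variable {V : Type*}

theorem hasHamiltonPath_iff_exists_list [DecidableEq V] [Nonempty V] (G : SimpleGraph V) :
    G.HasHamiltonPath ↔ ∃ l : List V, l.Nodup ∧ (∀ v, v ∈ l) ∧ l.IsChain G.Adj := by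
  constructor
  · rintro ⟨u, v, p, hp⟩
    exact ⟨p.support, hp.isPath.support_nodup, hp.mem_support, p.isChain_adj_support⟩
  · rintro ⟨l, hnd, hmem, hch⟩
    have hne : l ≠ [] := by
      rintro rfl
      exact absurd (hmem (Classical.arbitrary V)) (by simp)
    refine ⟨_, _, Walk.ofSupport l hne hch, ?_⟩
    intro a
    rw [Walk.support_ofSupport]
    exact List.count_eq_one_of_mem hnd (hmem a)

theorem HasHamiltonPath.mono [DecidableEq V] [Nonempty V] {G H : SimpleGraph V} (h : G ≤ H)
    (hG : G.HasHamiltonPath) : H.HasHamiltonPath := by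
  rw [hasHamiltonPath_iff_exists_list] at hG ⊢
  obtain ⟨l, h1, h2, h3⟩ := hG
  exact ⟨l, h1, h2, h3.imp fun _ _ hab => h hab⟩

theorem hasHamiltonPath_top [Fintype V] [DecidableEq V] [Nonempty V] :
    (⊤ : SimpleGraph V).HasHamiltonPath := by
  rw [hasHamiltonPath_iff_exists_list]
  refine ⟨Finset.univ.toList, Finset.nodup_toList _, by simp, ?_⟩
  have h := Finset.nodup_toList (Finset.univ : Finset V)
  exact List.Pairwise.isChain (h.imp fun h => h)

theorem degree_eq_countP [Fintype V] (G : SimpleGraph V) [DecidableRel G.Adj]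
    {l : List V} (hnd : l.Nodup) (hmem : ∀ v, v ∈ l) (v : V) :
    G.degree v = l.countP (fun w => G.Adj v w) := by
  classical
  rw [List.countP_eq_length_filter, ← List.toFinset_card_of_nodup (hnd.filter _),
    ← card_neighborFinset_eq_degree]
  congr 1
  ext w
  simp [hmem]

end Traceable

end SimpleGraph

/-- If no element satisfying `β` is immediately followed by one satisfying `α`, and the last
element does not satisfy `β`, then the shifted counts of `α` and `β` do not overlap. -/
theorem List.countP_tail_add_countP_lt_length {V : Type*} (α β : V → Bool) :
    ∀ l : List V, l ≠ [] →
    (∀ xs x y ys, l = xs ++ x :: y :: ys → β x = true → α y = true → False) →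
    (∀ xs x, l = xs ++ [x] → β x = false) →
    l.tail.countP α + l.countP β < l.length
  | [], h, _, _ => absurd rfl h
  | [x], _, _, h2 => by
    have := h2 [] x rfl
    simp [this]
  | x :: y :: ys, _, h1, h2 => by
    have ih := List.countP_tail_add_countP_lt_length α β (y :: ys) (by simp)
      (fun xs a b bs h => h1 (x :: xs) a b bs (by simp [h]))
      (fun xs a h => h2 (x :: xs) a (by simp [h]))
    have h3 := h1 [] x y ys rfl
    simp only [List.tail_cons, List.countP_cons, List.length_cons] at ih ⊢
    generalize (if β y = true then 1 else 0) = m at ih ⊢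
    cases hx : β x <;> cases hy : α y
    · simp only [Bool.false_eq_true, if_false]
      omega
    · simp only [Bool.false_eq_true, if_false, if_true]
      omega
    · simp only [Bool.false_eq_true, if_false, if_true]
      omega
    · exact (h3 hx hy).elim

/-! ### Ore and Chvátal degree conditions; the component-counting obstruction. -/

namespace SimpleGraph

variable {V : Type*}

/-- Rotating two disjoint paths starting at `u` and `v` along a crossing pair of edges. -/
theorem degree_count_lt_of_not_hasHamiltonPath [DecidableEq V] [Nonempty V]
    (G : SimpleGraph V) [DecidableRel G.Adj] (hG : ¬ G.HasHamiltonPath)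
    {u v : V} {p q : List V} (hp : (u :: p).IsChain G.Adj) (hq : (v :: q).IsChain G.Adj)
    (hnd : ((u :: p) ++ (v :: q)).Nodup) (hmem : ∀ w, w ∈ (u :: p) ++ (v :: q)) :
    (u :: p).countP (fun w => G.Adj u w) + (u :: p).countP (fun w => G.Adj v w)
      < (u :: p).length := by
  rw [hasHamiltonPath_iff_exists_list] at hG
  have key : ∀ l : List V, l.Perm ((u :: p) ++ (v :: q)) → ¬ l.IsChain G.Adj := by
    intro l hl hc
    exact hG ⟨l, hl.nodup_iff.2 hnd, fun w => hl.mem_iff.2 (hmem w), hc⟩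
  have h := List.countP_tail_add_countP_lt_length (fun w => decide (G.Adj u w))
    (fun w => decide (G.Adj v w)) (u :: p) (by simp) ?_ ?_
  · simpa [List.countP_cons] using h
  · intro xs x y ys he hx hy
    rw [decide_eq_true_eq] at hx hy
    -- Run from the far end of the first path back to `y`, jump to `u`, follow the path to `x`, and
    -- jump to `v`.
    refine key ((y :: ys).reverse ++ ((xs ++ [x]) ++ (v :: q))) ?_ ?_
    · rw [he]
      have h1 : (xs ++ x :: y :: ys) = (xs ++ [x]) ++ (y :: ys) := by simp
      rw [h1, ← List.append_assoc]
      refine List.Perm.append_right _ ?_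
      exact ((List.reverse_perm _).append_right _).trans List.perm_append_comm
    · rw [he, List.isChain_append_cons_cons] at hp
      obtain ⟨hp1, hp2, hp3⟩ := hp
      rw [List.isChain_append]
      refine ⟨?_, ?_, ?_⟩
      · rw [List.isChain_reverse]
        exact hp3.imp fun a b hab => hab.symm
      · rw [List.isChain_append]
        refine ⟨hp1, hq, ?_⟩
        simp [hx.symm]
      · have : ((xs ++ [x]) ++ (v :: q)).head? = some u := by
          cases xs with
          | nil => simp at he ⊢; exact he.1.symm
          | cons a xs => simp at he ⊢; exact he.1.symm
        rw [this]
        simp [hy.symm]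
  · intro xs x he
    rw [decide_eq_false_iff_not]
    intro hx
    refine key ((u :: p) ++ (v :: q)) (List.Perm.refl _) ?_
    rw [List.isChain_append]
    refine ⟨hp, hq, ?_⟩
    rw [he]
    simp [hx.symm]

/-- The crossing count applied to each of the two paths saves one on each, which accounts for the
`2`. -/
theorem degree_add_degree_lt_of_two_paths [Fintype V] [DecidableEq V] [Nonempty V]
    (G : SimpleGraph V) [DecidableRel G.Adj] (hG : ¬ G.HasHamiltonPath)
    {u v : V} {p q : List V} (hp : (u :: p).IsChain G.Adj) (hq : (v :: q).IsChain G.Adj)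
    (hnd : ((u :: p) ++ (v :: q)).Nodup) (hmem : ∀ w, w ∈ (u :: p) ++ (v :: q)) :
    G.degree u + G.degree v + 2 ≤ Fintype.card V := by
  have hcard : Fintype.card V = ((u :: p) ++ (v :: q)).length := by
    rw [← List.toFinset_card_of_nodup hnd, ← Finset.card_univ]
    congr 1
    ext w
    simp only [Finset.mem_univ, List.mem_toFinset, true_iff]
    exact hmem w
  have h1 := degree_count_lt_of_not_hasHamiltonPath G hG hp hq hnd hmem
  have h2 := degree_count_lt_of_not_hasHamiltonPath G hG hq hp
    (List.perm_append_comm.nodup_iff.1 hnd) (fun w => List.perm_append_comm.mem_iff.1 (hmem w))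
  rw [degree_eq_countP G hnd hmem u, degree_eq_countP G hnd hmem v, hcard, List.countP_append,
    List.countP_append, List.length_append]
  omega

/-- Adding `uv` creates a Hamilton path. It must use `uv`, and cutting it there leaves two disjoint
paths of `G` that start at `u` and `v` and cover all vertices. -/
theorem degree_add_degree_le_of_maximal [Fintype V] [DecidableEq V] [Nonempty V]
    (G : SimpleGraph V) [DecidableRel G.Adj]
    (hG : Maximal (fun H : SimpleGraph V => ¬ H.HasHamiltonPath) G)
    {u v : V} (huv : u ≠ v) (hadj : ¬ G.Adj u v) :
    G.degree u + G.degree v + 2 ≤ Fintype.card V := by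
  have hH : (G ⊔ edge u v).HasHamiltonPath := by
    by_contra h
    have := hG.2 h le_sup_left
    apply hadj
    apply this
    simp [edge_adj, huv]
  obtain ⟨l, hnd, hmem, hch⟩ := (hasHamiltonPath_iff_exists_list _).1 hH
  have hnot : ¬ l.IsChain G.Adj := fun h =>
    hG.1 ((hasHamiltonPath_iff_exists_list _).2 ⟨l, hnd, hmem, h⟩)
  rw [List.isChain_iff_forall_rel_of_append_cons_cons] at hnot
  push Not at hnot
  obtain ⟨a, b, l₁, l₂, hl, hab⟩ := hnot
  subst hl
  rw [List.isChain_append_cons_cons] at hch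
  obtain ⟨hc1, hc2, hc3⟩ := hch
  have hab' : (a = u ∧ b = v) ∨ (a = v ∧ b = u) := by
    rw [sup_adj, edge_adj] at hc2
    rcases hc2 with h | h
    · exact absurd h hab
    · exact h.1
  have hedge : ∀ x y, (G ⊔ edge u v).Adj x y → ¬ G.Adj x y →
      (x = a ∧ y = b) ∨ (x = b ∧ y = a) := by
    intro x y h1 h2
    rw [sup_adj, edge_adj] at h1
    rcases h1 with h1 | h1
    · exact absurd h1 h2
    · grind
  have hnd' : ((l₁ ++ [a]) ++ (b :: l₂)).Nodup := by simpa using hnd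
  have hdis := List.disjoint_of_nodup_append hnd'
  have hb : b ∉ l₁ ++ [a] := fun h => hdis h (by simp)
  have ha : a ∉ b :: l₂ := fun h => hdis (by simp) h
  have hc1' : (l₁ ++ [a]).IsChain G.Adj := by
    refine List.IsChain.imp_of_mem_imp (fun x y hx hy hxy => ?_) hc1
    by_contra h
    rcases hedge x y hxy h with h | h
    · exact hb (h.2 ▸ hy)
    · exact hb (h.1 ▸ hx)
  have hc3' : (b :: l₂).IsChain G.Adj := by
    refine List.IsChain.imp_of_mem_imp (fun x y hx hy hxy => ?_) hc3
    by_contra h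
    rcases hedge x y hxy h with h | h
    · exact ha (h.1 ▸ hx)
    · exact ha (h.2 ▸ hy)
  have hrev : (a :: l₁.reverse).IsChain G.Adj := by
    have : a :: l₁.reverse = (l₁ ++ [a]).reverse := by simp
    rw [this, List.isChain_reverse]
    exact hc1'.imp fun x y h => h.symm
  have hperm : ((a :: l₁.reverse) ++ (b :: l₂)).Perm (l₁ ++ a :: b :: l₂) := by
    have h1 : l₁ ++ a :: b :: l₂ = (l₁ ++ [a]) ++ (b :: l₂) := by simp
    have h2 : a :: l₁.reverse = (l₁ ++ [a]).reverse := by simp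
    rw [h1, h2]
    exact (List.reverse_perm _).append_right _
  have := degree_add_degree_lt_of_two_paths G hG.1 hrev hc3' (hperm.nodup_iff.2 hnd)
    (fun w => hperm.mem_iff.2 (hmem w))
  rcases hab' with ⟨rfl, rfl⟩ | ⟨rfl, rfl⟩ <;> omega

/-- Chvátal's degree condition for graphs without Hamilton path. -/
theorem exists_low_degree_sets_of_not_hasHamiltonPath [Fintype V] [DecidableEq V] [Nonempty V]
    (G : SimpleGraph V) [DecidableRel G.Adj] (hG : ¬ G.HasHamiltonPath) :
    ∃ (k : ℕ) (S R : Finset V), 1 ≤ k ∧ 2 * k ≤ Fintype.card V ∧ S ⊆ R ∧ S.card = k ∧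
      R.card + k = Fintype.card V + 1 ∧ (∀ v ∈ S, G.degree v + 1 ≤ k) ∧
      (∀ v ∈ R, G.degree v + k + 1 ≤ Fintype.card V) := by
  classical
  obtain ⟨H, hGH, hH⟩ := Finite.exists_le_maximal (p := fun H : SimpleGraph V =>
    ¬ H.HasHamiltonPath) hG
  have hdeg : ∀ v, G.degree v ≤ H.degree v := fun v => degree_le_of_le hGH
  have hore := fun (u v : V) (h : u ≠ v) (h' : ¬ H.Adj u v) =>
    degree_add_degree_le_of_maximal H hH h h'
  let P : Finset (V × V) := Finset.univ.filter fun x => x.1 ≠ x.2 ∧ ¬ H.Adj x.1 x.2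
  have hP : P.Nonempty := by
    by_contra h
    apply hH.1
    have : (⊤ : SimpleGraph V) ≤ H := by
      intro a b hab
      by_contra hn
      exact h ⟨(a, b), by simp [P, hn]; simpa using hab⟩
    exact hasHamiltonPath_top.mono this
  -- A nonadjacent pair of maximal degree sum, with `u` of the smaller degree; the parameter will be
  -- `k = H.degree u + 1`.
  obtain ⟨⟨u, v⟩, huvP, hmax⟩ := P.exists_max_image (fun x => H.degree x.1 + H.degree x.2) hP
  wlog hle : H.degree u ≤ H.degree v generalizing u v
  · refine this v u ?_ ?_ (by omega)
    · simp only [P, Finset.mem_filter, Finset.mem_univ, true_and] at huvP ⊢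
      exact ⟨huvP.1.symm, fun h => huvP.2 h.symm⟩
    · intro x hx
      have := hmax x hx
      simp only at this ⊢
      omega
  simp only [P, Finset.mem_filter, Finset.mem_univ, true_and, Prod.forall] at huvP hmax
  obtain ⟨huv, hadj⟩ := huvP
  have h0 := hore u v huv hadj
  set n := Fintype.card V with hn
  -- By maximality every non-neighbour `w ≠ v` of `v` has degree at most that of `u`, and the Ore
  -- bound makes these numerous.
  have hX : H.degree u + 1 ≤ (Finset.univ.filter fun w => H.degree w + 1 ≤ H.degree u + 1).card := by
    have hc : ((H.neighborFinset v ∪ {v})ᶜ).card = n - (H.degree v + 1) := by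
      rw [Finset.card_compl, Finset.card_union_of_disjoint (by simp)]
      simp [hn]
    have hs : ((H.neighborFinset v ∪ {v})ᶜ) ⊆
        (Finset.univ.filter fun w => H.degree w + 1 ≤ H.degree u + 1) := by
      intro w hw
      simp only [Finset.mem_compl, Finset.mem_union, mem_neighborFinset, Finset.mem_singleton,
        not_or] at hw
      have := hmax w v ⟨hw.2, fun h => hw.1 h.symm⟩
      simp
      omega
    have := Finset.card_le_card hs
    omega
  obtain ⟨S, hS, hSc⟩ := Finset.exists_subset_card_eq hX
  -- The vertices counted are the non-neighbours of `u`, including `u` itself, bounded by the Ore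
  -- inequality.
  have hY : n - H.degree u ≤
      (Finset.univ.filter fun w => H.degree w + (H.degree u + 1) + 1 ≤ n).card := by
    have hc : ((H.neighborFinset u)ᶜ).card = n - H.degree u := by
      rw [Finset.card_compl]
      simp [hn]
    have hs : ((H.neighborFinset u)ᶜ) ⊆
        (Finset.univ.filter fun w => H.degree w + (H.degree u + 1) + 1 ≤ n) := by
      intro w hw
      simp only [Finset.mem_compl, mem_neighborFinset] at hw
      simp only [Finset.mem_filter, Finset.mem_univ, true_and]
      by_cases h : u = w
      · subst h
        omega
      · have := hore u w h hw
        omega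
    rw [← hc]
    exact Finset.card_le_card hs
  have hSY : S ⊆ (Finset.univ.filter fun w => H.degree w + (H.degree u + 1) + 1 ≤ n) := by
    intro w hw
    have := hS hw
    simp only [Finset.mem_filter, Finset.mem_univ, true_and] at this ⊢
    omega
  obtain ⟨R, hSR, hR, hRc⟩ := Finset.exists_subsuperset_card_eq hSY (by omega) hY
  refine ⟨H.degree u + 1, S, R, by omega, by omega, hSR, hSc, by omega, ?_, ?_⟩
  · intro w hw
    have h1 := hS hw
    have h2 := hdeg w
    simp only [Finset.mem_filter, Finset.mem_univ, true_and] at h1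
    omega
  · intro w hw
    have h1 := hR hw
    have h2 := hdeg w
    simp only [Finset.mem_filter, Finset.mem_univ, true_and] at h1
    omega

/-- Removing the vertices with `f v = none` leaves components on which `f` is constant, so a
path through `l` sees at most one more value than there are removed vertices. -/
theorem card_filterMap_le_countP_add_one {C : Type*} [DecidableEq C] (G : SimpleGraph V)
    (f : V → Option C)
    (hf : ∀ u v c d, G.Adj u v → f u = some c → f v = some d → c = d) :
    ∀ l : List V, l.IsChain G.Adj →
      (l.filterMap f).toFinset.card ≤ l.countP (fun v => (f v).isNone) + 1 ∧
      (∀ v, l.head? = some v → f v = none →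
        (l.filterMap f).toFinset.card ≤ l.countP (fun v => (f v).isNone))
  | [], _ => by simp
  | x :: l, hl => by
    have ih := card_filterMap_le_countP_add_one G f hf l hl.tail
    cases hx : f x with
    | none =>
      have h := ih.1
      simp only [List.filterMap_cons_none hx, List.countP_cons, hx, Option.isNone_none, if_true]
      exact ⟨by omega, fun _ _ _ => h⟩
    | some c =>
      simp only [List.head?_cons, Option.some.injEq, forall_eq', hx, reduceCtorEq,
        IsEmpty.forall_iff, and_true]
      rw [List.filterMap_cons_some hx, List.countP_cons, List.toFinset_cons]
      simp only [hx, Option.isNone_some, Bool.false_eq_true, if_false, add_zero]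
      cases l with
      | nil => simp
      | cons y l =>
        cases hy : f y with
        | none =>
          -- `x` may contribute a new value, but a tail starting at a removed vertex has one to
          -- spare.
          have := ih.2 y rfl hy
          exact (Finset.card_insert_le _ _).trans (by omega)
        | some d =>
          have hcd := hf x y c d (by simpa using (List.isChain_cons_cons.1 hl).1) hx hy
          rw [Finset.insert_eq_of_mem]
          · exact ih.1
          · simp [hy, hcd]

theorem not_hasHamiltonPath_of_components [Fintype V] [DecidableEq V] [Nonempty V]
    {C : Type*} [Fintype C] [DecidableEq C] (G : SimpleGraph V) (f : V → Option C)
    (hf : ∀ u v c d, G.Adj u v → f u = some c → f v = some d → c = d)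
    (hsurj : ∀ c, ∃ v, f v = some c)
    (hcard : (Finset.univ.filter fun v => f v = none).card + 1 < Fintype.card C) :
    ¬ G.HasHamiltonPath := by
  rw [hasHamiltonPath_iff_exists_list]
  rintro ⟨l, hnd, hmem, hch⟩
  have h := (card_filterMap_le_countP_add_one G f hf l hch).1
  have h1 : (l.filterMap f).toFinset = Finset.univ := by
    ext c
    simpa [hmem] using hsurj c
  have h2 : l.countP (fun v => (f v).isNone) = (Finset.univ.filter fun v => f v = none).card := by
    rw [List.countP_eq_length_filter, ← List.toFinset_card_of_nodup (hnd.filter _)]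
    congr 1
    ext w
    simp [hmem]
  rw [h1, h2, Finset.card_univ] at h
  omega

theorem HasHamiltonPath.iso {W : Type*} [DecidableEq V] [DecidableEq W] {G : SimpleGraph V}
    {H : SimpleGraph W} (e : G ≃g H) (h : G.HasHamiltonPath) : H.HasHamiltonPath := by
  obtain ⟨u, v, p, hp⟩ := h
  exact ⟨_, _, p.map e.toHom, hp.map (f := e.toHom) e.bijective⟩

end SimpleGraph

namespace SimpleGraph

/-! ### Upper and lower bounds for the spectral radius. -/

section Spectral

variable {V : Type*} [Fintype V] [DecidableEq V] (G : SimpleGraph V) [DecidableRel G.Adj]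

/-- Every neighbour is charged `c`, and those in `B` a surplus `b - c`. This serves the middle class
of the three-class test vector. -/
theorem sum_neighborFinset_le_card_inter (v : V) (B : Finset V) (b c : ℝ)
    (y : V → ℝ) (hcb : c ≤ b) (hB : ∀ u ∈ B, y u ≤ b) (hc : ∀ u ∉ B, y u ≤ c) :
    ∑ u ∈ G.neighborFinset v, y u ≤ G.degree v * c + B.card * (b - c) := by
  calc ∑ u ∈ G.neighborFinset v, y u
      ≤ ∑ u ∈ G.neighborFinset v, (c + if u ∈ B then b - c else 0) := by
        refine Finset.sum_le_sum fun u _ => ?_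
        split_ifs with h
        · linarith [hB u h]
        · linarith [hc u h]
    _ = G.degree v * c + (G.neighborFinset v ∩ B).card * (b - c) := by
        rw [Finset.sum_add_distrib, Finset.sum_ite_mem]
        simp
        ring
    _ ≤ G.degree v * c + B.card * (b - c) := by
        have : ((G.neighborFinset v ∩ B).card : ℝ) ≤ B.card := by
          exact_mod_cast Finset.card_le_card Finset.inter_subset_right
        have := mul_le_mul_of_nonneg_right this (sub_nonneg.2 hcb)
        linarith

variable [Nonempty V]

theorem exists_adjSpectralRadius_eigenvector :
    ∃ x : V → ℝ, x ≠ 0 ∧ ∀ v, ∑ u ∈ G.neighborFinset v, x u = G.adjSpectralRadius * x v := by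
  obtain ⟨x, hx⟩ := (G.isGreatest_adjSpectralRadius.1).exists_hasEigenvector
  refine ⟨x, hx.2, fun v => ?_⟩
  have h := congrFun hx.apply_eq_smul v
  rwa [Matrix.toLin'_apply, adjMatrix_mulVec_apply, Pi.smul_apply, smul_eq_mul] at h

/-- Collatz–Wielandt upper bound. -/
theorem adjSpectralRadius_le_of_test_vector (y : V → ℝ) (hy : ∀ v, 0 < y v) (c : ℝ)
    (h : ∀ v, ∑ u ∈ G.neighborFinset v, y u ≤ c * y v) : G.adjSpectralRadius ≤ c := by
  obtain ⟨x, hx0, hx⟩ := G.exists_adjSpectralRadius_eigenvector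
  -- Comparing `|x|` with `y` where their ratio is largest avoids any need for a positive
  -- eigenvector.
  obtain ⟨v, -, hv⟩ := Finset.univ.exists_max_image (fun v => |x v| / y v) Finset.univ_nonempty
  have hv' : ∀ u, |x u| ≤ |x v| / y v * y u := fun u => by
    have := hv u (Finset.mem_univ u)
    rwa [div_le_iff₀ (hy u)] at this
  have hpos : 0 < |x v| := by
    rw [abs_pos]
    intro h0
    apply hx0
    funext u
    have := hv' u
    rw [h0] at this
    simpa using this
  have h1 : |G.adjSpectralRadius| * |x v| ≤ c * |x v| := by
    rw [← abs_mul, ← hx v]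
    calc |∑ u ∈ G.neighborFinset v, x u| ≤ ∑ u ∈ G.neighborFinset v, |x u| :=
          Finset.abs_sum_le_sum_abs _ _
      _ ≤ ∑ u ∈ G.neighborFinset v, |x v| / y v * y u := Finset.sum_le_sum fun u _ => hv' u
      _ = |x v| / y v * ∑ u ∈ G.neighborFinset v, y u := by rw [Finset.mul_sum]
      _ ≤ |x v| / y v * (c * y v) :=
          mul_le_mul_of_nonneg_left (h v) (div_nonneg (abs_nonneg _) (hy v).le)
      _ = c * |x v| := by
          have := (hy v).ne'
          field_simp
  exact (le_abs_self _).trans (le_of_mul_le_mul_right h1 hpos)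

/-- Hong's bound for graphs without isolated vertices. -/
theorem adjSpectralRadius_sq_le (hG : ∀ v, 1 ≤ G.degree v) :
    G.adjSpectralRadius ^ 2 + Fintype.card V ≤ (∑ v, G.degree v : ℕ) + 1 := by
  -- This bounds the row sums of the squared adjacency matrix: each non-neighbour of `v` other than
  -- `v` takes at least one from the total degree.
  have hrow : ∀ v, ∑ u ∈ G.neighborFinset v, G.degree u + Fintype.card V
      ≤ ∑ v, G.degree v + 1 := by
    intro v
    rw [← Finset.sum_add_sum_compl (G.neighborFinset v) fun u => G.degree u]
    have hv : v ∈ (G.neighborFinset v)ᶜ := by simp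
    rw [← Finset.add_sum_erase _ _ hv]
    have h1 : ((G.neighborFinset v)ᶜ.erase v).card ≤
        ∑ u ∈ (G.neighborFinset v)ᶜ.erase v, G.degree u := by
      rw [Finset.card_eq_sum_ones]
      exact Finset.sum_le_sum fun u _ => hG u
    rw [Finset.card_erase_of_mem hv, Finset.card_compl, card_neighborFinset_eq_degree] at h1
    omega
  obtain ⟨x, hx0, hx⟩ := G.exists_adjSpectralRadius_eigenvector
  obtain ⟨v, -, hv⟩ := Finset.univ.exists_max_image (fun v => |x v|) Finset.univ_nonempty
  have hpos : 0 < |x v| := by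
    rw [abs_pos]
    intro h0
    apply hx0
    funext u
    have := hv u (Finset.mem_univ u)
    rw [h0] at this
    simpa using this
  have h1 : G.adjSpectralRadius ^ 2 * |x v| ≤
      (∑ u ∈ G.neighborFinset v, G.degree u : ℕ) * |x v| := by
    calc G.adjSpectralRadius ^ 2 * |x v| = |G.adjSpectralRadius * (G.adjSpectralRadius * x v)| := by
          rw [← mul_assoc, abs_mul, ← sq, abs_sq]
      _ = |∑ u ∈ G.neighborFinset v, ∑ w ∈ G.neighborFinset u, x w| := by
          rw [← hx v, Finset.mul_sum]
          simp_rw [hx]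
      _ ≤ ∑ u ∈ G.neighborFinset v, ∑ w ∈ G.neighborFinset u, |x w| :=
          (Finset.abs_sum_le_sum_abs _ _).trans
            (Finset.sum_le_sum fun u _ => Finset.abs_sum_le_sum_abs _ _)
      _ ≤ ∑ u ∈ G.neighborFinset v, ∑ w ∈ G.neighborFinset u, |x v| :=
          Finset.sum_le_sum fun u _ => Finset.sum_le_sum fun w _ => hv w (Finset.mem_univ w)
      _ = (∑ u ∈ G.neighborFinset v, G.degree u : ℕ) * |x v| := by
          simp [Finset.sum_mul]
  have h2 := le_of_mul_le_mul_right h1 hpos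
  have h3 := hrow v
  have h4 : ((∑ u ∈ G.neighborFinset v, G.degree u : ℕ) : ℝ) + Fintype.card V
      ≤ (∑ v, G.degree v : ℕ) + 1 := by exact_mod_cast h3
  linarith

/-- The Rayleigh quotient is at most the spectral radius. -/
theorem sum_mul_le_adjSpectralRadius_mul (y : V → ℝ) :
    ∑ v, ∑ u ∈ G.neighborFinset v, y v * y u ≤ G.adjSpectralRadius * ∑ v, y v ^ 2 := by
  set A := G.adjMatrix ℝ with hAdef
  set r := G.adjSpectralRadius with hr
  have hA : A.IsHermitian := G.isHermitian_adjMatrix ℝ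
  have hB : (r • (1 : Matrix V V ℝ) - A).IsHermitian := by
    rw [Matrix.IsHermitian, Matrix.conjTranspose_sub, Matrix.conjTranspose_smul,
      Matrix.conjTranspose_one, hA.eq, star_trivial]
  have hpsd : (r • (1 : Matrix V V ℝ) - A).PosSemidef := by
    rw [hB.posSemidef_iff_eigenvalues_nonneg]
    intro i
    have h1 := hB.mulVec_eigenvectorBasis i
    set z : V → ℝ := ⇑(hB.eigenvectorBasis i) with hz
    have hz0 : z ≠ 0 := by
      intro h
      apply hB.eigenvectorBasis.toBasis.ne_zero i
      ext j
      simpa using congrFun h j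
    -- An eigenvalue `λ` of `r - A` yields the eigenvalue `r - λ` of `A`, which is at most `r`.
    have h2 : Module.End.HasEigenvalue (Matrix.toLin' A) (r - hB.eigenvalues i) := by
      refine Module.End.hasEigenvalue_of_hasEigenvector (x := z) ⟨?_, hz0⟩
      rw [Module.End.mem_eigenspace_iff, Matrix.toLin'_apply]
      rw [Matrix.sub_mulVec, Matrix.smul_mulVec, Matrix.one_mulVec] at h1
      rw [sub_smul, ← h1]
      abel
    have h3 := G.isGreatest_adjSpectralRadius.2 h2
    simp only [Pi.zero_apply]
    linarith
  have h := hpsd.dotProduct_mulVec_nonneg y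
  rw [Matrix.sub_mulVec, Matrix.smul_mulVec, Matrix.one_mulVec, dotProduct_sub] at h
  have e1 : star y ⬝ᵥ (r • y) = r * ∑ v, y v ^ 2 := by
    simp only [dotProduct, Pi.star_apply, star_trivial, Pi.smul_apply, smul_eq_mul, Finset.mul_sum]
    exact Finset.sum_congr rfl fun v _ => by ring
  have e2 : star y ⬝ᵥ A.mulVec y = ∑ v, ∑ u ∈ G.neighborFinset v, y v * y u := by
    simp only [dotProduct, Pi.star_apply, star_trivial, hAdef, adjMatrix_mulVec_apply,
      Finset.mul_sum]
  rw [e1, e2] at h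
  linarith

/-- Lets the trial vector be written on the concrete vertex type of an exceptional graph. -/
theorem lt_adjSpectralRadius_of_iso {W : Type*} [Fintype W] {H : SimpleGraph W}
    [DecidableRel H.Adj] (e : G ≃g H) (y : W → ℝ) (c : ℝ)
    (h : c * ∑ w, y w ^ 2 < ∑ w, ∑ w', if H.Adj w w' then y w * y w' else 0) :
    c < G.adjSpectralRadius := by
  have h1 := G.sum_mul_le_adjSpectralRadius_mul (y ∘ e)
  have e1 : ∑ v, (y ∘ e) v ^ 2 = ∑ w, y w ^ 2 := e.toEquiv.sum_comp fun w => y w ^ 2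
  have e2 : ∑ v, ∑ u ∈ G.neighborFinset v, (y ∘ e) v * (y ∘ e) u =
      ∑ w, ∑ w', if H.Adj w w' then y w * y w' else 0 := by
    rw [← e.toEquiv.sum_comp]
    refine Finset.sum_congr rfl fun v _ => ?_
    rw [← e.toEquiv.sum_comp, neighborFinset_eq_filter, Finset.sum_filter]
    refine Finset.sum_congr rfl fun u _ => ?_
    have : H.Adj (e.toEquiv v) (e.toEquiv u) ↔ G.Adj v u := e.map_rel_iff
    simp only [this]
    rfl
  rw [e1, e2] at h1
  by_contra hc
  push Not at hc
  have h2 : 0 ≤ ∑ w, y w ^ 2 := Finset.sum_nonneg fun _ _ => sq_nonneg _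
  have := mul_le_mul_of_nonneg_right hc h2
  linarith

/-- A spectral bound from a three-class degree condition: `k` vertices of degree at most `k - 1`,
`k - 1` vertices of unrestricted degree, and all others of degree at most `n - k - 1`. -/
theorem adjSpectralRadius_le_of_low_degree_sets {k : ℕ} {S R : Finset V} (hk : 3 ≤ k)
    (hkn : 2 * k ≤ Fintype.card V) (hexc : ¬ (k = 3 ∧ Fintype.card V = 6)) (hSR : S ⊆ R)
    (hS : S.card = k) (hR : R.card + k = Fintype.card V + 1) (hdS : ∀ v ∈ S, G.degree v + 1 ≤ k)
    (hdR : ∀ v ∈ R, G.degree v + k + 1 ≤ Fintype.card V) :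
    G.adjSpectralRadius ≤ Fintype.card V - 3 := by
  set n := Fintype.card V with hn
  have hkn' : (2 : ℝ) * k ≤ n := by exact_mod_cast hkn
  have hk' : (3 : ℝ) ≤ k := by exact_mod_cast hk
  set N : ℝ := n - 3 with hN
  set K : ℝ := (k : ℝ) with hK
  have hNK : 2 * K - 3 ≤ N := by linarith
  -- The test vector is `b` on `Rᶜ`, `1` on `S` and `c` on `R \ S`. The values `b` and `c` make the
  -- estimates for rows in `S` and in `R \ S` exact, leaving only the rows in `Rᶜ`.
  set b : ℝ := N / (K - 1) with hb
  set c : ℝ := N / (2 * K - 3) with hc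
  have hK1 : 0 < K - 1 := by linarith
  have hK3 : 0 < 2 * K - 3 := by linarith
  have hN0 : 0 < N := by linarith
  have hbK : (K - 1) * b = N := by rw [hb]; field_simp
  have hcK : (2 * K - 3) * c = N := by rw [hc]; field_simp
  have hc1 : 1 ≤ c := by rw [hc, le_div_iff₀ hK3]; linarith
  have hcb : c ≤ b := by
    rw [hc, hb]
    exact div_le_div_of_nonneg_left hN0.le hK1 (by linarith)
  -- The condition for rows in `Rᶜ` with denominators cleared. At `k = 3`, `n = 6` it would read `18
  -- ≤ 12`, hence the exclusion.
  have hkey : K * (K - 1) * (2 * K - 3) ≤ (K - 2) * N * (N + 1) := by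
    by_cases h3 : k = 3
    · have : 7 ≤ n := by omega
      have h7 : (7 : ℝ) ≤ n := by exact_mod_cast this
      have hK' : K = 3 := by rw [hK, h3]; norm_num
      rw [hK']
      have : 4 ≤ N := by linarith
      nlinarith
    · have h4 : (4 : ℝ) ≤ K := by
        have : 4 ≤ k := by omega
        rw [hK]
        exact_mod_cast this
      have e1 : (2 * K - 3) * (2 * K - 2) ≤ N * (N + 1) := by nlinarith
      have e2 : (K - 2) * ((2 * K - 3) * (2 * K - 2)) ≤ (K - 2) * (N * (N + 1)) :=
        mul_le_mul_of_nonneg_left e1 (by linarith)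
      have e3 : 0 ≤ (K - 1) * (2 * K - 3) * (K - 4) :=
        mul_nonneg (mul_nonneg hK1.le hK3.le) (by linarith)
      nlinarith
  have hbig : (K - 2) * b + (n - 2 * K + 1) * c + K ≤ N * b := by
    have hnN : (n : ℝ) = N + 3 := by rw [hN]; ring
    rw [hnN, ← sub_nonneg]
    have : N * b - ((K - 2) * b + (N + 3 - 2 * K + 1) * c + K) =
        ((K - 2) * N * (N + 1) - K * (K - 1) * (2 * K - 3)) / ((K - 1) * (2 * K - 3)) := by
      rw [eq_div_iff (mul_pos hK1 hK3).ne']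
      linear_combination (N - (K - 2)) * (2 * K - 3) * hbK - (N + 4 - 2 * K) * (K - 1) * hcK
    rw [this]
    exact div_nonneg (by linarith) (by positivity)
  have hSc : ∀ v ∈ S, v ∉ Rᶜ := fun v hv => by simpa using hSR hv
  have hRc : Rᶜ.card + 1 = k := by
    rw [Finset.card_compl]
    have := Finset.card_le_univ R
    omega
  have hRc' : (Rᶜ.card : ℝ) = K - 1 := by
    rw [hK, ← hRc]; push_cast; ring
  let y : V → ℝ := fun v => if v ∈ Rᶜ then b else if v ∈ S then 1 else c
  have hyc : ∀ v ∉ Rᶜ, y v ≤ c := by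
    intro v hv
    simp only [y, if_neg hv]
    split_ifs <;> linarith
  have hyb : ∀ v ∈ Rᶜ, y v = b := fun v hv => by simp only [y, if_pos hv]
  have hyle : ∀ v, y v ≤ b := by
    intro v
    by_cases h : v ∈ Rᶜ
    · rw [hyb v h]
    · exact (hyc v h).trans hcb
  have hypos : ∀ v, 0 < y v := by
    intro v
    simp only [y]
    split_ifs <;> linarith
  refine G.adjSpectralRadius_le_of_test_vector y hypos N fun v => ?_
  by_cases hvR : v ∈ Rᶜ
  · rw [hyb v hvR]
    have hsub : ∑ u ∈ G.neighborFinset v, y u ≤ ∑ u ∈ Finset.univ.erase v, y u := by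
      refine Finset.sum_le_sum_of_subset_of_nonneg ?_ fun u _ _ => (hypos u).le
      intro u hu
      simp only [mem_neighborFinset] at hu
      simpa using hu.ne'
    have htot : ∑ u, y u = (K - 1) * b + (n - 2 * K + 1) * c + K := by
      have e1 : ∑ u ∈ Rᶜ, y u = (K - 1) * b := by
        rw [Finset.sum_congr rfl hyb, Finset.sum_const, nsmul_eq_mul, hRc']
      have e2 : ∑ u ∈ S, y u = K := by
        rw [Finset.sum_congr rfl (g := fun _ => (1 : ℝ)) fun u hu => ?_]
        · rw [Finset.sum_const, nsmul_eq_mul, hS, mul_one]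
        · simp only [y, if_neg (hSc u hu), if_pos hu]
      have e3 : ∑ u ∈ R \ S, y u = (n - 2 * K + 1) * c := by
        rw [Finset.sum_congr rfl (g := fun _ => c) fun u hu => ?_]
        · rw [Finset.sum_const, nsmul_eq_mul, Finset.card_sdiff_of_subset hSR, hS,
            Nat.cast_sub (by omega)]
          have : (R.card : ℝ) + K = n + 1 := by rw [hK]; exact_mod_cast hR
          congr 1
          linarith
        · rw [Finset.mem_sdiff] at hu
          have : u ∉ Rᶜ := by simpa using hu.1
          simp only [y, if_neg this, if_neg hu.2]
      rw [← Finset.sum_add_sum_compl R, e1, ← Finset.sum_sdiff hSR, e2, e3]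
      ring
    have herase : ∑ u ∈ Finset.univ.erase v, y u + y v = ∑ u, y u :=
      Finset.sum_erase_add _ _ (Finset.mem_univ v)
    rw [hyb v hvR] at herase
    linarith
  · have hvR' : v ∈ R := by simpa using hvR
    by_cases hvS : v ∈ S
    · have hyv : y v = 1 := by simp only [y, if_neg hvR, if_pos hvS]
      rw [hyv]
      have hd : (G.degree v : ℝ) + 1 ≤ K := by rw [hK]; exact_mod_cast hdS v hvS
      calc ∑ u ∈ G.neighborFinset v, y u ≤ ∑ u ∈ G.neighborFinset v, b :=
            Finset.sum_le_sum fun u _ => hyle u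
        _ = G.degree v * b := by simp
        _ ≤ (K - 1) * b := mul_le_mul_of_nonneg_right (by linarith) (by linarith)
        _ = N * 1 := by rw [hbK, mul_one]
    · have hyv : y v = c := by simp only [y, if_neg hvR, if_neg hvS]
      rw [hyv]
      have hd : (G.degree v : ℝ) + K + 1 ≤ n := by rw [hK]; exact_mod_cast hdR v hvR'
      have h1 := G.sum_neighborFinset_le_card_inter v Rᶜ b c y hcb
        (fun u hu => (hyb u hu).le) hyc
      rw [hRc'] at h1
      have h2 : (G.degree v : ℝ) * c ≤ (n - K - 1) * c :=
        mul_le_mul_of_nonneg_right (by linarith) (by linarith)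
      have h3 : (n - K - 1) * c + (K - 1) * (b - c) = N * c := by
        have : (n : ℝ) = N + 3 := by rw [hN]; ring
        rw [this]
        linear_combination hbK - hcK
      linarith

end Spectral

end SimpleGraph

namespace SimpleGraph

/-! ### The extremal structure for `k = 2`. -/

section Structure

theorem nonempty_iso_of_injective {V W : Type*} [Fintype V] [Fintype W] {G : SimpleGraph V}
    {H : SimpleGraph W} (φ : W → V) (hφ : Function.Injective φ)
    (hcard : Fintype.card W = Fintype.card V)
    (h : ∀ x y, G.Adj (φ x) (φ y) ↔ H.Adj x y) : Nonempty (G ≃g H) :=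
  ⟨(RelIso.mk (Equiv.ofBijective φ ((Fintype.bijective_iff_injective_and_card φ).2 ⟨hφ, hcard⟩))
    (by intro x y; exact h x y) : H ≃g G).symm⟩

variable {V : Type*} [Fintype V] [DecidableEq V] (G : SimpleGraph V) [DecidableRel G.Adj]

/-- A vertex partition into a dominating vertex, a clique, and two pendant vertices. -/
theorem nonempty_iso_join_clique_add_two {n : ℕ} (hn : 4 ≤ n) (hcard : Fintype.card V = n)
    {S R : Finset V} (hSR : S ⊆ R) (hS : S.card = 2) (hR : R.card + 1 = n)
    (hdS : ∀ v ∈ S, G.degree v ≤ 1) (hdR : ∀ v ∈ R, G.degree v + 3 ≤ n)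
    (hD : n ^ 2 + 10 ≤ ∑ v, G.degree v + 5 * n) :
    Nonempty (G ≃g join (completeGraph (Fin 1))
      (completeGraph (Fin (n - 3)) ⊕g (⊥ : SimpleGraph (Fin 2)))) := by
  obtain ⟨m, rfl⟩ : ∃ m, n = m + 4 := ⟨n - 4, by omega⟩
  have hRc : Rᶜ.card = 1 := by rw [Finset.card_compl]; omega
  obtain ⟨z, hz⟩ := Finset.card_eq_one.1 hRc
  have hM : (R \ S).card = m + 1 := by rw [Finset.card_sdiff_of_subset hSR]; omega
  have hzR : z ∉ R := by
    have : z ∈ Rᶜ := by rw [hz]; simp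
    simpa using this
  have hsum : ∑ v, G.degree v = (∑ v ∈ R \ S, G.degree v + ∑ v ∈ S, G.degree v) + G.degree z := by
    rw [← Finset.sum_add_sum_compl R, ← Finset.sum_sdiff hSR, hz, Finset.sum_singleton]
  have hdM : ∀ v ∈ R \ S, G.degree v ≤ m + 1 := fun v hv => by
    have := hdR v (Finset.mem_sdiff.1 hv).1
    omega
  have h1 : ∑ v ∈ S, G.degree v ≤ 2 := by
    have := Finset.sum_le_card_nsmul S _ 1 hdS
    rwa [hS] at this
  have h2 : ∑ v ∈ R \ S, G.degree v ≤ (m + 1) * (m + 1) := by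
    have := Finset.sum_le_card_nsmul (R \ S) _ (m + 1) hdM
    rwa [hM] at this
  have h3 : G.degree z + 1 ≤ m + 4 := by
    have := G.degree_lt_card_verts z
    omega
  -- The three upper bounds add up to exactly the lower bound `hD`, so each is an equality, vertex
  -- by vertex.
  have hz' : G.degree z = m + 3 := by nlinarith
  have h1' : ∑ v ∈ S, G.degree v = ∑ v ∈ S, 1 := by
    rw [Finset.sum_const, hS]
    simp only [smul_eq_mul]
    nlinarith
  have h2' : ∑ v ∈ R \ S, G.degree v = ∑ v ∈ R \ S, (m + 1) := by
    rw [Finset.sum_const, hM, smul_eq_mul]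
    nlinarith
  have hS1 := (Finset.sum_eq_sum_iff_of_le hdS).1 h1'
  have hM1 := (Finset.sum_eq_sum_iff_of_le hdM).1 h2'
  have hzN : G.neighborFinset z = Finset.univ.erase z := by
    apply Finset.eq_of_subset_of_card_le
    · intro w hw
      rw [mem_neighborFinset] at hw
      simpa using hw.ne'
    · rw [Finset.card_erase_of_mem (Finset.mem_univ z), Finset.card_univ,
        card_neighborFinset_eq_degree]
      omega
  have hzadj : ∀ w, w ≠ z → G.Adj z w := by
    intro w hw
    rw [← mem_neighborFinset, hzN]
    simpa using hw
  have hSadj : ∀ s ∈ S, ∀ w, G.Adj s w ↔ w = z := by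
    intro s hs w
    have hsz : s ≠ z := fun h => hzR (h ▸ hSR hs)
    have : G.neighborFinset s = {z} := by
      symm
      apply Finset.eq_of_subset_of_card_le
      · simpa using (hzadj s hsz).symm
      · simp [hS1 s hs]
    rw [← mem_neighborFinset, this, Finset.mem_singleton]
  have hMadj : ∀ v ∈ R \ S, ∀ w ∈ R \ S, G.Adj v w ↔ v ≠ w := by
    intro v hv w hw
    rw [Finset.mem_sdiff] at hv hw
    have hvz : v ≠ z := fun h => hzR (h ▸ hv.1)
    -- Vertices of `S` see only `z`, so `v` has just `m + 1` possible neighbours, and its degree is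
    -- `m + 1`.
    have : G.neighborFinset v = Sᶜ.erase v := by
      apply Finset.eq_of_subset_of_card_le
      · intro x hx
        rw [mem_neighborFinset] at hx
        rw [Finset.mem_erase, Finset.mem_compl]
        exact ⟨hx.ne', fun hxS => hvz ((hSadj x hxS v).1 hx.symm)⟩
      · rw [Finset.card_erase_of_mem (by simpa using hv.2), Finset.card_compl,
          card_neighborFinset_eq_degree, hM1 v (Finset.mem_sdiff.2 hv)]
        omega
    rw [← mem_neighborFinset, this, Finset.mem_erase, Finset.mem_compl]
    exact ⟨fun h => h.1.symm, fun h => ⟨h.symm, hw.2⟩⟩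
  let eM := (Finset.equivFinOfCardEq (s := R \ S) (n := m + 4 - 3) (by omega)).symm
  let eS := (Finset.equivFinOfCardEq hS).symm
  have hMS : ∀ i j, ((eM i : V)) ≠ eS j := fun i j h =>
    (Finset.mem_sdiff.1 (eM i).2).2 (h ▸ (eS j).2)
  have hMz : ∀ i, ((eM i : V)) ≠ z := fun i h => hzR (h ▸ (Finset.mem_sdiff.1 (eM i).2).1)
  have hSz : ∀ i, ((eS i : V)) ≠ z := fun i h => hzR (h ▸ hSR (eS i).2)
  have hMz' : ∀ i, z ≠ (eM i : V) := fun i => (hMz i).symm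
  have hSz' : ∀ i, z ≠ (eS i : V) := fun i => (hSz i).symm
  refine nonempty_iso_of_injective
    (Sum.elim (fun _ => z) (Sum.elim (fun i => (eM i : V)) (fun i => (eS i : V)))) ?_ ?_ ?_
  · rintro (x | x | x) (y | y | y) h
    · rw [Subsingleton.elim x y]
    · exact absurd h (hMz' y)
    · exact absurd h (hSz' y)
    · exact absurd h (hMz x)
    · exact congrArg _ (congrArg _ (eM.injective (Subtype.ext h)))
    · exact absurd h (hMS x y)
    · exact absurd h (hSz x)
    · exact absurd h.symm (hMS y x)
    · exact congrArg _ (congrArg _ (eS.injective (Subtype.ext h)))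
  · simp only [Fintype.card_sum, Fintype.card_fin]
    omega
  · rintro (x | x | x) (y | y | y)
    · simp [join, Subsingleton.elim x y]
    · simp [join, hzadj _ (hMz y)]
    · simp [join, hzadj _ (hSz y)]
    · simp [join, (hzadj _ (hMz x)).symm]
    · simp only [Sum.elim_inr, Sum.elim_inl, hMadj _ (eM x).2 _ (eM y).2]
      simp [join]
    · have : ¬ G.Adj (eM x) (eS y) := fun h => hMz x ((hSadj _ (eS y).2 _).1 h.symm)
      simp [join, this]
    · simp [join, (hzadj _ (hSz x)).symm]
    · have : ¬ G.Adj (eS x) (eM y) := fun h => hMz y ((hSadj _ (eS x).2 _).1 h)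
      simp [join, this]
    · have : ¬ G.Adj (eS x) (eS y) := fun h => hSz y ((hSadj _ (eS x).2 _).1 h)
      simp [join, this]

end Structure

/-! ### Adjacency as a number, turning edge counts into linear arithmetic. -/

section AdjCount

variable {V : Type*} (G : SimpleGraph V) [DecidableRel G.Adj]

/-- The adjacency indicator. -/
def adjCount (v w : V) : ℕ := if G.Adj v w then 1 else 0

theorem adjCount_comm (v w : V) : G.adjCount v w = G.adjCount w v := by
  simp [adjCount, G.adj_comm]

theorem adjCount_self (v : V) : G.adjCount v v = 0 := by simp [adjCount]

theorem adjCount_le_one (v w : V) : G.adjCount v w ≤ 1 := by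
  unfold adjCount; split_ifs <;> simp

theorem adjCount_eq_one_iff (v w : V) : G.adjCount v w = 1 ↔ G.Adj v w := by
  simp [adjCount]

theorem adjCount_eq_zero_iff (v w : V) : G.adjCount v w = 0 ↔ ¬ G.Adj v w := by
  simp [adjCount]

theorem degree_eq_adjCount_sum [Fintype V] {a b s t p q : V} (hnd : [a, b, s, t, p, q].Nodup)
    (hmem : ∀ v, v ∈ [a, b, s, t, p, q]) (v : V) :
    G.degree v = G.adjCount v a + G.adjCount v b + G.adjCount v s + G.adjCount v t +
      G.adjCount v p + G.adjCount v q := by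
  rw [degree_eq_countP G hnd hmem]
  simp only [List.countP_cons, List.countP_nil, adjCount, decide_eq_true_eq]
  ring

end AdjCount

/-! ### The case `k = 3`, `n = 6`. -/

section SixVertices

variable {V : Type*} [Fintype V] [DecidableEq V]

theorem sum_eq_of_six {a b s t p q : V} (hnd : [a, b, s, t, p, q].Nodup)
    (hmem : ∀ v, v ∈ [a, b, s, t, p, q]) (f : V → ℕ) :
    ∑ v, f v = f a + f b + f s + f t + f p + f q := by
  have : Finset.univ = [a, b, s, t, p, q].toFinset := by
    ext v
    simp only [Finset.mem_univ, List.mem_toFinset, true_iff]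
    exact hmem v
  rw [this, List.sum_toFinset f hnd]
  simp [add_assoc]

theorem nodup_and_mem_of_compl {R : Finset V} {a b s t p q : V} (hR : R = {s, t, p, q})
    (hRc : Rᶜ = {a, b}) (hab : a ≠ b) (hnd : [s, t, p, q].Nodup) :
    [a, b, s, t, p, q].Nodup ∧ ∀ v, v ∈ [a, b, s, t, p, q] := by
  have hm : ∀ v, v = a ∨ v = b ↔ v ∉ R := by
    intro v
    rw [← Finset.mem_compl, hRc]
    simp
  have hr : ∀ v, v ∈ R ↔ v ∈ [s, t, p, q] := by
    intro v
    rw [hR]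
    simp
  constructor
  · have ha : a ∉ [s, t, p, q] := by rw [← hr]; exact (hm a).1 (Or.inl rfl)
    have hb : b ∉ [s, t, p, q] := by rw [← hr]; exact (hm b).1 (Or.inr rfl)
    refine List.nodup_cons.2 ⟨?_, List.nodup_cons.2 ⟨hb, hnd⟩⟩
    rw [List.mem_cons, not_or]
    exact ⟨hab, ha⟩
  · intro v
    have h1 := hm v
    have h2 := hr v
    rw [List.mem_cons, List.mem_cons, ← h2]
    tauto

theorem nonempty_iso_join_two_four (G : SimpleGraph V) {R : Finset V} (hR : R.card = 4)
    (hRc : Rᶜ.card = 2) (hRR : ∀ v ∈ R, ∀ w ∈ R, ¬ G.Adj v w)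
    (hcross : ∀ v ∈ Rᶜ, ∀ w ∈ R, G.Adj v w)
    (hcc : ∀ v ∈ Rᶜ, ∀ w ∈ Rᶜ, v ≠ w → G.Adj v w) :
    Nonempty (G ≃g join (completeGraph (Fin 2)) (⊥ : SimpleGraph (Fin 4))) := by
  let eC := (Finset.equivFinOfCardEq hRc).symm
  let eR := (Finset.equivFinOfCardEq hR).symm
  have hne : ∀ i j, (eC i : V) ≠ eR j := fun i j h =>
    (Finset.mem_compl.1 (eC i).2) (h ▸ (eR j).2)
  have hcc' : ∀ i j, i ≠ j → G.Adj (eC i) (eC j) := fun i j h =>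
    hcc _ (eC i).2 _ (eC j).2 fun h' => h (eC.injective (Subtype.ext h'))
  refine nonempty_iso_of_injective
    (Sum.elim (fun i => (eC i : V)) (fun i => (eR i : V))) ?_ ?_ ?_
  · rintro (x | x) (y | y) h
    · exact congrArg _ (eC.injective (Subtype.ext h))
    · exact absurd h (hne x y)
    · exact absurd h.symm (hne y x)
    · exact congrArg _ (eR.injective (Subtype.ext h))
  · rw [← Finset.card_add_card_compl R]
    simp [hR, hRc]
  · rintro (x | x) (y | y)
    · by_cases h : x = y
      · simp [join, h]
      · simp [join, h, hcc' x y h]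
    · simp [join, hcross _ (eC x).2 _ (eR y).2]
    · simp [join, (hcross _ (eC y).2 _ (eR x).2).symm]
    · simp [join, hRR _ (eR x).2 _ (eR y).2]

variable (G : SimpleGraph V) [DecidableRel G.Adj]

/-- Each pair is written in one fixed order, so that `omega` sees one variable per potential edge;
halving the degree sum gives the `8`. -/
theorem adjCount_bounds_of_six {R : Finset V} {a b s t p q : V} (hR : R = {s, t, p, q})
    (hnd : [a, b, s, t, p, q].Nodup) (hmem : ∀ v, v ∈ [a, b, s, t, p, q])
    (hd : ∀ v ∈ R, G.degree v ≤ 2) (hD : 16 ≤ ∑ v, G.degree v) :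
    (G.adjCount a s + G.adjCount b s + G.adjCount s t + G.adjCount s p + G.adjCount s q ≤ 2) ∧
    (G.adjCount a t + G.adjCount b t + G.adjCount s t + G.adjCount t p + G.adjCount t q ≤ 2) ∧
    (G.adjCount a p + G.adjCount b p + G.adjCount s p + G.adjCount t p + G.adjCount p q ≤ 2) ∧
    (G.adjCount a q + G.adjCount b q + G.adjCount s q + G.adjCount t q + G.adjCount p q ≤ 2) ∧
    8 ≤ G.adjCount a b + (G.adjCount a s + G.adjCount b s) + (G.adjCount a t + G.adjCount b t) +
      (G.adjCount a p + G.adjCount b p) + (G.adjCount a q + G.adjCount b q) +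
      (G.adjCount s t + G.adjCount s p + G.adjCount s q + G.adjCount t p + G.adjCount t q +
        G.adjCount p q) := by
  have hdeg := G.degree_eq_adjCount_sum hnd hmem
  rw [sum_eq_of_six hnd hmem] at hD
  have d1 := hd s (by simp [hR])
  have d2 := hd t (by simp [hR])
  have d3 := hd p (by simp [hR])
  have d4 := hd q (by simp [hR])
  simp only [hdeg, adjCount_self] at d1 d2 d3 d4 hD
  rw [G.adjCount_comm s a, G.adjCount_comm s b] at d1 hD
  rw [G.adjCount_comm t a, G.adjCount_comm t b, G.adjCount_comm t s] at d2 hD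
  rw [G.adjCount_comm p a, G.adjCount_comm p b, G.adjCount_comm p s, G.adjCount_comm p t] at d3 hD
  rw [G.adjCount_comm q a, G.adjCount_comm q b, G.adjCount_comm q s, G.adjCount_comm q t,
    G.adjCount_comm q p] at d4 hD
  rw [G.adjCount_comm b a] at hD
  omega

/-- With `e ≥ 1` edges inside `R`, the degree bounds allow at most `8 - 2e` edges leaving `R`, hence
at most `9 - e` in all. So `e = 1` and everything is tight: `p` and `q` see both `a` and `b`, while
`t` sees one of them. -/
theorem hasHamiltonPath_of_six [Nonempty V] {R : Finset V} (hR : R.card = 4)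
    (hRc : Rᶜ.card = 2) (hd : ∀ v ∈ R, G.degree v ≤ 2) (hD : 16 ≤ ∑ v, G.degree v)
    {s t : V} (hs : s ∈ R) (ht : t ∈ R) (hst : G.Adj s t) : G.HasHamiltonPath := by
  obtain ⟨a, b, hab, hRab⟩ := Finset.card_eq_two.1 hRc
  have ht' : t ∈ R.erase s := Finset.mem_erase.2 ⟨hst.ne', ht⟩
  obtain ⟨p, q, hpq, hRpq⟩ : ∃ p q, p ≠ q ∧ (R.erase s).erase t = {p, q} :=
    Finset.card_eq_two.1
      (by rw [Finset.card_erase_of_mem ht', Finset.card_erase_of_mem hs, hR])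
  have hR' : R = {s, t, p, q} := by
    rw [← hRpq, Finset.insert_erase ht', Finset.insert_erase hs]
  have hp : p ∈ (R.erase s).erase t := by rw [hRpq]; simp
  have hq : q ∈ (R.erase s).erase t := by rw [hRpq]; simp
  simp only [Finset.mem_erase] at hp hq
  obtain ⟨hnd, hmem⟩ := nodup_and_mem_of_compl hR' hRab hab (by
    simp only [List.nodup_cons, List.mem_cons, List.not_mem_nil, or_false, not_or]
    exact ⟨⟨hst.ne, hp.2.1.symm, hq.2.1.symm⟩, ⟨hp.1.symm, hq.1.symm⟩, hpq, by simp, by simp⟩)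
  have hb := G.adjCount_bounds_of_six hR' hnd hmem hd hD
  have h1 := G.adjCount_le_one
  have hst1 := (G.adjCount_eq_one_iff s t).2 hst
  have u1 := h1 a b
  have u2 := h1 a p
  have u3 := h1 b p
  have u4 := h1 a q
  have u5 := h1 b q
  have ap : G.Adj a p := (G.adjCount_eq_one_iff a p).1 (by omega)
  have bp : G.Adj b p := (G.adjCount_eq_one_iff b p).1 (by omega)
  have aq : G.Adj a q := (G.adjCount_eq_one_iff a q).1 (by omega)
  have bq : G.Adj b q := (G.adjCount_eq_one_iff b q).1 (by omega)
  have hor : G.Adj a t ∨ G.Adj b t := by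
    by_contra hn
    rw [not_or, ← G.adjCount_eq_zero_iff, ← G.adjCount_eq_zero_iff] at hn
    omega
  rw [hasHamiltonPath_iff_exists_list]
  rcases hor with h | h
  · have hperm : [s, t, a, p, b, q].Perm [a, b, s, t, p, q] := by grind
    refine ⟨_, hperm.nodup_iff.2 hnd, fun v => hperm.mem_iff.2 (hmem v), ?_⟩
    simp [hst, h.symm, ap, bp.symm, bq]
  · have hperm : [s, t, b, p, a, q].Perm [a, b, s, t, p, q] := by grind
    refine ⟨_, hperm.nodup_iff.2 hnd, fun v => hperm.mem_iff.2 (hmem v), ?_⟩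
    simp [hst, h.symm, bp, ap.symm, aq]

/-- Only nine edges are possible, `ab` and the eight across, and eight are present, so `bq` is the
only one missing. Then `a` is the hub, `b` the centre of the star and `q` the pendant vertex. -/
theorem nonempty_iso_join_star_add_one {R : Finset V} (hR : R.card = 4)
    (hRc : Rᶜ.card = 2) (hd : ∀ v ∈ R, G.degree v ≤ 2) (hD : 16 ≤ ∑ v, G.degree v)
    (hRR : ∀ v ∈ R, ∀ w ∈ R, ¬ G.Adj v w)
    {b q : V} (hb : b ∈ Rᶜ) (hq : q ∈ R) (hbq : ¬ G.Adj b q) :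
    Nonempty (G ≃g join (completeGraph (Fin 1))
      (completeBipartiteGraph (Fin 1) (Fin 3) ⊕g completeGraph (Fin 1))) := by
  obtain ⟨a, hRa⟩ : ∃ a, Rᶜ.erase b = {a} :=
    Finset.card_eq_one.1 (by rw [Finset.card_erase_of_mem hb, hRc])
  obtain ⟨s, t, p, hst, hsp, htp, hRstp⟩ : ∃ s t p, s ≠ t ∧ s ≠ p ∧ t ≠ p ∧
      R.erase q = {s, t, p} :=
    Finset.card_eq_three.1 (by rw [Finset.card_erase_of_mem hq, hR])
  have hRab : Rᶜ = {a, b} := by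
    rw [← Finset.insert_erase hb, hRa, Finset.pair_comm]
  have hab : a ≠ b := by
    have : a ∈ Rᶜ.erase b := by rw [hRa]; simp
    exact (Finset.mem_erase.1 this).1
  have hR' : R = {s, t, p, q} := by
    rw [← Finset.insert_erase hq, hRstp]
    ext v
    simp only [Finset.mem_insert, Finset.mem_singleton]
    tauto
  have hs : s ∈ R.erase q := by rw [hRstp]; simp
  have ht : t ∈ R.erase q := by rw [hRstp]; simp
  have hp : p ∈ R.erase q := by rw [hRstp]; simp
  rw [Finset.mem_erase] at hs ht hp
  obtain ⟨hnd, hmem⟩ := nodup_and_mem_of_compl hR' hRab hab (by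
    simp only [List.nodup_cons, List.mem_cons, List.not_mem_nil, or_false, not_or]
    exact ⟨⟨hst, hsp, hs.1⟩, ⟨htp, ht.1⟩, hp.1, by simp, by simp⟩)
  have hbd := G.adjCount_bounds_of_six hR' hnd hmem hd hD
  have h1 := G.adjCount_le_one
  have h0 := fun v hv w hw => (G.adjCount_eq_zero_iff v w).2 (hRR v hv w hw)
  have z0 := (G.adjCount_eq_zero_iff b q).2 hbq
  have z1 := h0 s hs.2 t ht.2
  have z2 := h0 s hs.2 p hp.2
  have z3 := h0 s hs.2 q hq
  have z4 := h0 t ht.2 p hp.2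
  have z5 := h0 t ht.2 q hq
  have z6 := h0 p hp.2 q hq
  have u1 := h1 a b
  have u2 := h1 a q
  have u3 := h1 a s
  have u4 := h1 a t
  have u5 := h1 a p
  have u6 := h1 b s
  have u7 := h1 b t
  have u8 := h1 b p
  have aq : G.Adj a q := (G.adjCount_eq_one_iff a q).1 (by omega)
  have eab : G.Adj a b := (G.adjCount_eq_one_iff a b).1 (by omega)
  have as : G.Adj a s := (G.adjCount_eq_one_iff a s).1 (by omega)
  have eat : G.Adj a t := (G.adjCount_eq_one_iff a t).1 (by omega)
  have ap : G.Adj a p := (G.adjCount_eq_one_iff a p).1 (by omega)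
  have bs : G.Adj b s := (G.adjCount_eq_one_iff b s).1 (by omega)
  have bt : G.Adj b t := (G.adjCount_eq_one_iff b t).1 (by omega)
  have bp : G.Adj b p := (G.adjCount_eq_one_iff b p).1 (by omega)
  have hRR' : ∀ v ∈ [s, t, p, q], ∀ w ∈ [s, t, p, q], ¬ G.Adj v w := fun v hv w hw =>
    hRR v (by rw [hR']; simpa using hv) w (by rw [hR']; simpa using hw)
  simp only [List.mem_cons, List.not_mem_nil, or_false, forall_eq_or_imp, forall_eq] at hRR'
  obtain ⟨⟨-, st, sp, sq⟩, ⟨ts, -, tp, tq⟩, ⟨ps, pt, -, pq⟩, ⟨qs, qt, qp, -⟩⟩ := hRR'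
  have hqb : ¬ G.Adj q b := fun h => hbq h.symm
  refine nonempty_iso_of_injective
    (Sum.elim (fun _ => a) (Sum.elim (Sum.elim (fun _ => b) ![s, t, p]) (fun _ => q))) ?_ ?_ ?_
  · simp only [List.nodup_cons, List.mem_cons, List.not_mem_nil, or_false, not_or] at hnd
    rintro (x | (x | x) | x) (y | (y | y) | y) h <;> fin_cases x <;> fin_cases y <;>
      simp at h ⊢ <;> grind
  · rw [← Finset.card_add_card_compl R]
    simp [hR, hRc]
  · rintro (x | (x | x) | x) (y | (y | y) | y) <;> fin_cases x <;> fin_cases y <;>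
      simp [join, aq, eab, as, eat, ap, bs, bt, bp, hbq, hqb, st, sp, sq, ts, tp, tq, ps, pt, pq,
        qs, qt, qp, aq.symm, eab.symm, as.symm, eat.symm, ap.symm, bs.symm, bt.symm, bp.symm]

/-- Disposes of `K_{2,4}`. With weights `1` on `R` and `3/2` elsewhere, the row sums are at most `3`
and `4 ≤ 9/2`. -/
theorem adjSpectralRadius_le_three_of_six [Nonempty V] {R : Finset V} (hR : R.card = 4)
    (hd : ∀ v ∈ R, G.degree v ≤ 2) (hcc : ∀ v ∈ Rᶜ, ∀ w ∈ Rᶜ, ¬ G.Adj v w) :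
    G.adjSpectralRadius ≤ 3 := by
  refine G.adjSpectralRadius_le_of_test_vector (fun v => if v ∈ R then 1 else 3 / 2)
    (fun v => by split_ifs <;> norm_num) 3 fun v => ?_
  by_cases hv : v ∈ R
  · have h2 : (G.degree v : ℝ) ≤ 2 := by exact_mod_cast hd v hv
    calc ∑ u ∈ G.neighborFinset v, (if u ∈ R then (1 : ℝ) else 3 / 2)
        ≤ ∑ u ∈ G.neighborFinset v, (3 / 2 : ℝ) :=
          Finset.sum_le_sum fun u _ => by split_ifs <;> norm_num
      _ = G.degree v * (3 / 2) := by simp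
      _ ≤ 3 * (if v ∈ R then (1 : ℝ) else 3 / 2) := by rw [if_pos hv]; linarith
  · have hsub : G.neighborFinset v ⊆ R := by
      intro w hw
      by_contra hwR
      exact hcc v (Finset.mem_compl.2 hv) w (Finset.mem_compl.2 hwR)
        ((G.mem_neighborFinset v w).1 hw)
    have h4 : ((G.neighborFinset v).card : ℝ) ≤ 4 := by
      have := Finset.card_le_card hsub
      rw [hR] at this
      exact_mod_cast this
    rw [if_neg hv, Finset.sum_congr rfl (g := fun _ => (1 : ℝ)) fun u hu => if_pos (hsub hu)]
    simp only [Finset.sum_const, nsmul_eq_mul, mul_one]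
    linarith

theorem hasHamiltonPath_or_iso_of_six [Nonempty V] {R : Finset V} (hR : R.card = 4)
    (hRc : Rᶜ.card = 2) (hd : ∀ v ∈ R, G.degree v ≤ 2) (hD : 16 ≤ ∑ v, G.degree v)
    (hρ : 3 < G.adjSpectralRadius) : G.HasHamiltonPath ∨
    Nonempty (G ≃g join (completeGraph (Fin 2)) (⊥ : SimpleGraph (Fin 4))) ∨
    Nonempty (G ≃g join (completeGraph (Fin 1))
      (completeBipartiteGraph (Fin 1) (Fin 3) ⊕g completeGraph (Fin 1))) := by
  by_cases hRR : ∀ v ∈ R, ∀ w ∈ R, ¬ G.Adj v w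
  · right
    by_cases hcross : ∀ v ∈ Rᶜ, ∀ w ∈ R, G.Adj v w
    · left
      refine G.nonempty_iso_join_two_four hR hRc hRR hcross ?_
      obtain ⟨a, b, hab, hRab⟩ := Finset.card_eq_two.1 hRc
      have hadj : G.Adj a b := by
        by_contra hn
        refine absurd hρ (not_lt.2 (G.adjSpectralRadius_le_three_of_six hR hd ?_))
        have hn' : ¬ G.Adj b a := fun h => hn h.symm
        simp [hRab, hn, hn']
      simp [hRab, hadj, hadj.symm]
    · right
      push Not at hcross
      obtain ⟨b, hb, q, hq, hbq⟩ := hcross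
      exact G.nonempty_iso_join_star_add_one hR hRc hd hD hRR hb hq hbq
  · left
    push Not at hRR
    obtain ⟨s, hs, t, ht, hst⟩ := hRR
    exact G.hasHamiltonPath_of_six hR hRc hd hD hs ht hst

end SixVertices

end SimpleGraph

/-! ### Assembling the cases. -/

namespace SimpleGraph

theorem hasHamiltonPath_or_isExceptional {V : Type*} [Fintype V] [DecidableEq V]
    (G : SimpleGraph V) [DecidableRel G.Adj] {n : ℕ} (hn : 4 ≤ n) (hcard : Fintype.card V = n)
    (hδ : ∀ v, 1 ≤ G.degree v) (hρ : (n : ℝ) - 3 < G.adjSpectralRadius) :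
    G.HasHamiltonPath ∨ G.IsExceptional n := by
  have : Nonempty V := Fintype.card_pos_iff.1 (by omega)
  by_cases hG : G.HasHamiltonPath
  · exact Or.inl hG
  have hD : n ^ 2 + 10 ≤ ∑ v, G.degree v + 5 * n := by
    have h1 := G.adjSpectralRadius_sq_le hδ
    have hn' : (4 : ℝ) ≤ n := by exact_mod_cast hn
    have h2 : ((n : ℝ) - 3) ^ 2 < G.adjSpectralRadius ^ 2 := by
      apply pow_lt_pow_left₀ hρ (by linarith) (by norm_num)
    rw [hcard] at h1
    rw [G.sum_degrees_eq_twice_card_edges] at h1 ⊢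
    have h3 : (n : ℝ) ^ 2 + 8 < (2 * G.edgeFinset.card : ℕ) + 5 * n := by nlinarith
    have h4 : n ^ 2 + 8 < 2 * G.edgeFinset.card + 5 * n := by exact_mod_cast h3
    -- Both `n² - 5n` and the degree sum are even, which lifts the bound by one to the tight value
    -- for `k = 2`.
    obtain ⟨r, hr⟩ := Nat.even_mul_succ_self n
    have : n ^ 2 = n * (n + 1) - n := by rw [mul_add, mul_one, Nat.add_sub_cancel, sq]
    omega
  obtain ⟨k, S, R, hk1, hkn, hSR, hS, hR, hdS, hdR⟩ :=
    G.exists_low_degree_sets_of_not_hasHamiltonPath hG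
  have hk : k ≠ 1 := by
    rintro rfl
    obtain ⟨s, hs⟩ := Finset.card_pos.1 (by omega : 0 < S.card)
    have := hdS s hs
    have := hδ s
    omega
  by_cases hk2 : k = 2
  · subst hk2
    refine Or.inr (Or.inl (G.nonempty_iso_join_clique_add_two hn hcard hSR hS (by omega)
      (fun v hv => ?_) (fun v hv => ?_) hD))
    · have := hdS v hv
      omega
    · have := hdR v hv
      omega
  by_cases h6 : k = 3 ∧ n = 6
  · obtain ⟨rfl, rfl⟩ := h6
    have hR4 : R.card = 4 := by omega
    have hRc : Rᶜ.card = 2 := by rw [Finset.card_compl]; omega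
    rcases G.hasHamiltonPath_or_iso_of_six hR4 hRc (fun v hv => by have := hdR v hv; omega)
      (by omega) (by norm_num at hρ; linarith) with h | h | h
    · exact Or.inl h
    · exact Or.inr (Or.inr (Or.inl h))
    · exact Or.inr (Or.inr (Or.inr h))
  · have := G.adjSpectralRadius_le_of_low_degree_sets (by omega) hkn (by rwa [hcard]) hSR hS hR
      hdS hdR
    rw [hcard] at this
    exact absurd hρ (not_lt.2 this)

theorem one_le_minDegree_of_iso {V W : Type*} [Fintype V] [Nonempty V] {G : SimpleGraph V}
    [DecidableRel G.Adj] {H : SimpleGraph W} (e : G ≃g H) (h : ∀ w, ∃ w', H.Adj w w') :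
    1 ≤ G.minDegree := by
  apply le_minDegree_of_forall_le_degree
  intro v
  obtain ⟨w, hw⟩ := h (e v)
  rw [Nat.one_le_iff_ne_zero, ← Nat.pos_iff_ne_zero, degree_pos_iff_exists_adj]
  refine ⟨e.symm w, ?_⟩
  rw [← e.map_rel_iff]
  simpa using hw

/-! ### The three families are genuine exceptions. -/

section JoinCliqueAddTwo

theorem exists_adj_join_clique_add_two (m : ℕ) (w : Fin 1 ⊕ (Fin m ⊕ Fin 2)) :
    ∃ w', (join (completeGraph (Fin 1))
      (completeGraph (Fin m) ⊕g (⊥ : SimpleGraph (Fin 2)))).Adj w w' := by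
  rcases w with w | w
  · exact ⟨Sum.inr (Sum.inr 0), by simp [join]⟩
  · exact ⟨Sum.inl 0, by simp [join]⟩

/-- Deleting the hub leaves three components: the clique, labelled `none`, and two single vertices.
-/
theorem not_hasHamiltonPath_join_clique_add_two {m : ℕ} (hm : 1 ≤ m) :
    ¬ (join (completeGraph (Fin 1))
      (completeGraph (Fin m) ⊕g (⊥ : SimpleGraph (Fin 2)))).HasHamiltonPath := by
  refine not_hasHamiltonPath_of_components (C := Option (Fin 2)) _
    (Sum.elim (fun _ => none) (Sum.elim (fun _ => some none) fun i => some (some i))) ?_ ?_ ?_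
  · rintro (x | x | x) (y | y | y) c d h hc hd <;>
      (simp [join] at h hc hd; try grind)
  · rintro (_ | i)
    · exact ⟨Sum.inr (Sum.inl ⟨0, hm⟩), rfl⟩
    · exact ⟨Sum.inr (Sum.inr i), rfl⟩
  · rw [Finset.card_filter, Fintype.sum_sum_type, Fintype.sum_sum_type]
    simp

theorem lt_adjSpectralRadius_of_iso_join_clique_add_two {V : Type*} [Fintype V] [DecidableEq V]
    [Nonempty V] {G : SimpleGraph V} [DecidableRel G.Adj] {m : ℕ} (hm : 1 ≤ m)
    (e : G ≃g join (completeGraph (Fin 1))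
      (completeGraph (Fin m) ⊕g (⊥ : SimpleGraph (Fin 2)))) :
    (m : ℝ) < G.adjSpectralRadius := by
  classical
  have hm' : (0 : ℝ) < m := by exact_mod_cast hm
  refine G.lt_adjSpectralRadius_of_iso e
    -- Hub and clique form `K_{m+1}`, of spectral radius `m`; the pendant weight `1/m` maximises the
    -- gain `4t - 2mt²` over weights `t`.
    (Sum.elim (fun _ => 1) (Sum.elim (fun _ => 1) fun _ => 1 / (m : ℝ))) _ ?_
  have hclique : ∀ i : Fin m, ∑ j : Fin m, (if (join (completeGraph (Fin 1))
      (completeGraph (Fin m) ⊕g (⊥ : SimpleGraph (Fin 2)))).Adj (Sum.inr (Sum.inl i))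
      (Sum.inr (Sum.inl j)) then (1 : ℝ) else 0) = m - 1 := by
    intro i
    have : (Finset.univ.filter fun j : Fin m => (join (completeGraph (Fin 1))
      (completeGraph (Fin m) ⊕g (⊥ : SimpleGraph (Fin 2)))).Adj (Sum.inr (Sum.inl i))
      (Sum.inr (Sum.inl j))) = Finset.univ.erase i := by
      ext j
      simp [join, eq_comm]
    rw [Finset.sum_boole, this, Finset.card_erase_of_mem (Finset.mem_univ i), Finset.card_univ,
      Fintype.card_fin, Nat.cast_sub hm, Nat.cast_one]
  simp only [Fintype.sum_sum_type, Sum.elim_inl, Sum.elim_inr, one_mul, mul_one, hclique]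
  simp [join]
  field_simp
  nlinarith

end JoinCliqueAddTwo

section JoinTwoFour

theorem exists_adj_join_two_four (w : Fin 2 ⊕ Fin 4) :
    ∃ w', (join (completeGraph (Fin 2)) (⊥ : SimpleGraph (Fin 4))).Adj w w' := by
  rcases w with w | w
  · exact ⟨Sum.inr 0, by simp [join]⟩
  · exact ⟨Sum.inl 0, by simp [join]⟩

theorem not_hasHamiltonPath_join_two_four :
    ¬ (join (completeGraph (Fin 2)) (⊥ : SimpleGraph (Fin 4))).HasHamiltonPath := by
  refine not_hasHamiltonPath_of_components (C := Fin 4) _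
    (Sum.elim (fun _ => none) fun i => some i) ?_ ?_ ?_
  · rintro (x | x) (y | y) c d h hc hd <;> simp [join] at h hc hd
  · exact fun i => ⟨Sum.inr i, rfl⟩
  · rw [Finset.card_filter, Fintype.sum_sum_type]
    simp

theorem three_lt_adjSpectralRadius_of_iso_join_two_four {V : Type*} [Fintype V] [DecidableEq V]
    [Nonempty V] {G : SimpleGraph V} [DecidableRel G.Adj]
    (e : G ≃g join (completeGraph (Fin 2)) (⊥ : SimpleGraph (Fin 4))) :
    3 < G.adjSpectralRadius := by
  classical
  -- The Rayleigh quotient is `40/12`.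
  refine G.lt_adjSpectralRadius_of_iso e (Sum.elim (fun _ => 2) fun _ => 1) _ ?_
  simp [join, Fintype.sum_sum_type, Fin.sum_univ_succ]
  norm_num

end JoinTwoFour

section JoinStarAddOne

theorem exists_adj_join_star_add_one (w : Fin 1 ⊕ ((Fin 1 ⊕ Fin 3) ⊕ Fin 1)) :
    ∃ w', (join (completeGraph (Fin 1))
      (completeBipartiteGraph (Fin 1) (Fin 3) ⊕g completeGraph (Fin 1))).Adj w w' := by
  rcases w with w | w
  · exact ⟨Sum.inr (Sum.inr 0), by simp [join]⟩
  · exact ⟨Sum.inl 0, by simp [join]⟩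

/-- Deleting the hub and the centre of the star leaves four isolated vertices. -/
theorem not_hasHamiltonPath_join_star_add_one :
    ¬ (join (completeGraph (Fin 1))
      (completeBipartiteGraph (Fin 1) (Fin 3) ⊕g completeGraph (Fin 1))).HasHamiltonPath := by
  refine not_hasHamiltonPath_of_components (C := Option (Fin 3)) _
    (Sum.elim (fun _ => none) (Sum.elim (Sum.elim (fun _ => none) fun i => some (some i))
      fun _ => some none)) ?_ ?_ ?_
  · rintro (x | (x | x) | x) (y | (y | y) | y) c d h hc hd <;>
      (simp [join] at h hc hd; try grind)
  · rintro (_ | i)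
    · exact ⟨Sum.inr (Sum.inr 0), rfl⟩
    · exact ⟨Sum.inr (Sum.inl (Sum.inr i)), rfl⟩
  · rw [Finset.card_filter, Fintype.sum_sum_type, Fintype.sum_sum_type, Fintype.sum_sum_type]
    simp

theorem three_lt_adjSpectralRadius_of_iso_join_star_add_one {V : Type*} [Fintype V]
    [DecidableEq V] [Nonempty V] {G : SimpleGraph V} [DecidableRel G.Adj]
    (e : G ≃g join (completeGraph (Fin 1))
      (completeBipartiteGraph (Fin 1) (Fin 3) ⊕g completeGraph (Fin 1))) :
    3 < G.adjSpectralRadius := by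
  classical
  refine G.lt_adjSpectralRadius_of_iso e
    -- The Rayleigh quotient is `96/31`, just above `3`.
    (Sum.elim (fun _ => 3) (Sum.elim (Sum.elim (fun _ => 3) fun _ => 2) fun _ => 1)) _ ?_
  simp [join, Fintype.sum_sum_type, Fin.sum_univ_succ]
  norm_num

end JoinStarAddOne

theorem IsExceptional.one_le_minDegree_and_lt_and_not {V : Type*} [Fintype V] [DecidableEq V]
    {G : SimpleGraph V} [DecidableRel G.Adj] {n : ℕ} (hn : 4 ≤ n) (hcard : Fintype.card V = n)
    (h : G.IsExceptional n) :
    1 ≤ G.minDegree ∧ (n : ℝ) - 3 < G.adjSpectralRadius ∧ ¬ G.HasHamiltonPath := by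
  have : Nonempty V := Fintype.card_pos_iff.1 (by omega)
  rcases h with ⟨⟨e⟩⟩ | ⟨⟨e⟩⟩ | ⟨⟨e⟩⟩
  · refine ⟨one_le_minDegree_of_iso e (exists_adj_join_clique_add_two _), ?_,
      fun h => not_hasHamiltonPath_join_clique_add_two (by omega) (h.iso e)⟩
    have := lt_adjSpectralRadius_of_iso_join_clique_add_two (by omega) e
    rwa [Nat.cast_sub (by omega)] at this
  · have h6 : n = 6 := by rw [← hcard, Fintype.card_congr e.toEquiv]; simp
    refine ⟨one_le_minDegree_of_iso e exists_adj_join_two_four, ?_,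
      fun h => not_hasHamiltonPath_join_two_four (h.iso e)⟩
    have := three_lt_adjSpectralRadius_of_iso_join_two_four e
    rw [h6]
    norm_num
    exact this
  · have h6 : n = 6 := by rw [← hcard, Fintype.card_congr e.toEquiv]; simp
    refine ⟨one_le_minDegree_of_iso e exists_adj_join_star_add_one, ?_,
      fun h => not_hasHamiltonPath_join_star_add_one (h.iso e)⟩
    have := three_lt_adjSpectralRadius_of_iso_join_star_add_one e
    rw [h6]
    norm_num
    exact this

end SimpleGraph

/-- For a graph on `n ≥ 4` vertices: minimum degree at least `1` and `ρ(G) > n - 3` force a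
Hamilton path unless `G` is exceptional, and every exceptional graph is a genuine exception. -/
theorem theorem1 {V : Type*} [Fintype V] [DecidableEq V] (G : SimpleGraph V)
    [DecidableRel G.Adj] (n : ℕ) (hn : 4 ≤ n) (hcard : Fintype.card V = n) :
    (1 ≤ G.minDegree → (n : ℝ) - 3 < G.adjSpectralRadius →
      G.HasHamiltonPath ∨ G.IsExceptional n) ∧
    (G.IsExceptional n →
      1 ≤ G.minDegree ∧ (n : ℝ) - 3 < G.adjSpectralRadius ∧ ¬ G.HasHamiltonPath) := by

  refine ⟨fun hδ hρ => ?_, fun h => h.one_le_minDegree_and_lt_and_not hn hcard⟩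
  exact G.hasHamiltonPath_or_isExceptional hn hcard
    (fun v => hδ.trans (G.minDegree_le_degree v)) hρ
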